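/- Let $n\ge 1$, let $B_R(p)$ denote the open ball of radius $R$ and centre $p$ in $\mathbb{R}^n$, and let $B_1=B_1(c)$ be a unit ball. For real functions $b_0,b_1\in C^{1,1}(B_1)$ (that is, differentiable with $\|b_j\|_{C^2(B_1)}:=\sup_{B_1}|b_j|+\sup_{B_1}|\nabla b_j|+\mathrm{Lip}_{B_1}(\nabla b_j)<\infty$) let $$b_{\mathrm{env}}:=\sup\{f : f \text{ is subharmonic on } B_1,\ f\le\min\{b_0,b_1\} \text{ on } B_1\}$$ be the subharmonic envelope, and let $\Lambda:=\{x\in B_1 : b_{\mathrm{env}}(x)=\min\{b_0,b_1\}(x)\}$ be the contact set. There is a constant $C=C(n,\|b_0\|_{C^2(B_1)},\|b_1\|_{C^2(B_1)})$, depending only on $n$ and on the two norms, such that the following holds. If $x_0\in\Lambda\cap B_{1/4}(c)$ and $\min\{b_0,b_1\}(x_0)=b_i(x_0)$ with $i\in\{0,1\}$, then $$|b_{\mathrm{env}}(x)-b_i(x_0)-\langle\nabla b_i(x_0),x-x_0\rangle|\le C\,|x-x_0|^2\qquad\text{for all } x\in B_{1/8}(x_0).$$ -/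

import Mathlib

open Set Metric InnerProductSpace
open scoped ENNReal Gradient

/-- `u : U → [-∞, ∞)` is subharmonic on the open set `U`: it is upper semicontinuous on `U`, never
`+∞`, and for every closed ball `closedBall y r ⊆ U` and every function `h` that is continuous on
the closed ball and harmonic in the open ball, `u ≤ h` on the sphere implies `u ≤ h` in the ball.
(The function `-∞` is admitted. Values of `u` outside `U` play no role.) -/
structure IsSubharmonicOn {n : ℕ} (u : EuclideanSpace ℝ (Fin n) → EReal)
    (U : Set (EuclideanSpace ℝ (Fin n))) : Prop where
  lt_top : ∀ x ∈ U, u x < ⊤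
  upperSemicontinuousOn : UpperSemicontinuousOn u U
  le_harmonic : ∀ (y : EuclideanSpace ℝ (Fin n)) (r : ℝ), 0 < r → closedBall y r ⊆ U →
    ∀ h : EuclideanSpace ℝ (Fin n) → ℝ, ContinuousOn h (closedBall y r) →
      HarmonicOnNhd h (ball y r) →
      (∀ z ∈ sphere y r, u z ≤ (h z : EReal)) → ∀ z ∈ ball y r, u z ≤ (h z : EReal)

/-- The upper envelope `sup {f ∈ SH(U) : f ≤ φ on U}` of the subharmonic functions on `U` that lie
below the obstacle `φ`, with values in `[-∞, ∞]`. -/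
noncomputable def subharmonicEnvelope {n : ℕ} (U : Set (EuclideanSpace ℝ (Fin n)))
    (φ : EuclideanSpace ℝ (Fin n) → ℝ) (x : EuclideanSpace ℝ (Fin n)) : EReal :=
  sSup {t : EReal | ∃ f : EuclideanSpace ℝ (Fin n) → EReal,
    IsSubharmonicOn f U ∧ (∀ z ∈ U, f z ≤ (φ z : EReal)) ∧ t = f x}

/-- The contact set: the points of `U` where the envelope equals the obstacle. -/
def contactSet {n : ℕ} (U : Set (EuclideanSpace ℝ (Fin n)))
    (φ : EuclideanSpace ℝ (Fin n) → ℝ) : Set (EuclideanSpace ℝ (Fin n)) :=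
  {x | x ∈ U ∧ subharmonicEnvelope U φ x = (φ x : EReal)}

/-- The `C²` norm on an open set `U` in the `C^{1,1}` sense, with values in `[0, ∞]`: the sum of
`sup |f|`, `sup |∇f|` and the best Lipschitz constant of `∇f` (on a ball, the latter is the
essential supremum of the operator norm of the Hessian). The quotient is `0` for `x = y`. -/
noncomputable def c2Norm {n : ℕ} (U : Set (EuclideanSpace ℝ (Fin n)))
    (f : EuclideanSpace ℝ (Fin n) → ℝ) : ℝ≥0∞ :=
  (⨆ x ∈ U, ‖f x‖ₑ) + (⨆ x ∈ U, ‖∇ f x‖ₑ) +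
    ⨆ x ∈ U, ⨆ y ∈ U, ‖∇ f x - ∇ f y‖ₑ / edist x y

/-- `f ∈ C^{1,1}(U)`: `f` is differentiable on the open set `U` and has finite `C²` norm there. -/
def MemC11 {n : ℕ} (U : Set (EuclideanSpace ℝ (Fin n)))
    (f : EuclideanSpace ℝ (Fin n) → ℝ) : Prop :=
  DifferentiableOn ℝ f U ∧ c2Norm U f < ⊤

/-! The upper bound is immediate: the envelope lies below `b i`, which lies below its tangent
paraboloid at `x₀`. The content is the lower bound, `le_subharmonicEnvelope_of_mem_contactSet`.

Let `r = ‖x - x₀‖`. Contact at `x₀` gives a competitor whose value at `x₀` is within `r ^ 2` of `b i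
x₀`. `IsSubharmonicOn.exists_continuous` makes it a continuous `F`, at the cost of moving `x₀` to a
point `p` at distance at most `r ^ 2` and losing `O(r ^ 2)`. Let `H` be harmonic and nearly equal to
`F` on the sphere of radius `2r` about `p` (`exists_harmonic_near_on_sphere`). Both obstacles are
semiconcave, so subtracting a paraboloid of size `O(r ^ 2)` from `H` keeps it below them in the ball
(`harmonic_add_quadratic_le`). Gluing the result to `F` yields a new competitor
(`IsSubharmonicOn.glue`), and the envelope is at least `H x - O(r ^ 2)`.

It remains to bound `H x` from below. The tangent plane of `b i` plus `O(r ^ 2)` minus `H` is a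
nonnegative harmonic function on the ball, of size `O(r ^ 2)` at `p`, so `harnack_of_harmonic`
bounds it by `O(r ^ 2)` at `x`. -/

open scoped Laplacian

/-! ### Laplacian computations -/

theorem laplacian_eq_sum_fderiv {n : ℕ} (f : EuclideanSpace ℝ (Fin n) → ℝ)
    (x : EuclideanSpace ℝ (Fin n)) :
    (Δ f) x = ∑ i, fderiv ℝ (fderiv ℝ f) x (EuclideanSpace.single i 1)
      (EuclideanSpace.single i 1) := by
  rw [laplacian_eq_iteratedFDeriv_orthonormalBasis f (EuclideanSpace.basisFun (Fin n) ℝ)]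
  simp [iteratedFDeriv_two_apply]

theorem laplacian_comp_smul_add {n : ℕ} (f : EuclideanSpace ℝ (Fin n) → ℝ) (a : ℝ)
    (v x : EuclideanSpace ℝ (Fin n)) :
    (Δ (fun y => f (a • y + v))) x = a ^ 2 * (Δ f) (a • x + v) := by
  have key : ∀ {F : Type} [NormedAddCommGroup F] [NormedSpace ℝ F]
      (g : EuclideanSpace ℝ (Fin n) → F) (y : EuclideanSpace ℝ (Fin n)),
      fderiv ℝ (fun y => g (a • y + v)) y = a • fderiv ℝ g (a • y + v) := by
    intro F _ _ g y
    have := fderiv_comp_smul (𝕜 := ℝ) (f := fun z => g (z + v)) (c := a) (x := y)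
    rw [this, fderiv_comp_add_right]
  simp only [laplacian_eq_sum_fderiv, Finset.mul_sum]
  refine Finset.sum_congr rfl fun i _ => ?_
  have h1 : fderiv ℝ (fun y => f (a • y + v)) = fun y => a • fderiv ℝ f (a • y + v) :=
    funext fun y => key f y
  rw [h1]
  have h2 : fderiv ℝ (fun y => a • fderiv ℝ f (a • y + v)) x
      = a • fderiv ℝ (fun y => fderiv ℝ f (a • y + v)) x := by
    exact congrFun (fderiv_const_smul_field (𝕜 := ℝ) a
      (f := fun y => fderiv ℝ f (a • y + v))) x
  rw [h2, key (fderiv ℝ f) x]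
  simp [pow_two, mul_assoc]

theorem laplacian_norm_sub_sq {n : ℕ} (p x : EuclideanSpace ℝ (Fin n)) :
    (Δ (fun y => ‖y - p‖ ^ 2)) x = 2 * (n : ℝ) := by
  have h1 : fderiv ℝ (fun y : EuclideanSpace ℝ (Fin n) => ‖y - p‖ ^ 2)
      = fun y => (2 : ℝ) • innerSL ℝ (y - p) := by
    funext y
    have : HasFDerivAt (fun z : EuclideanSpace ℝ (Fin n) => ‖z - p‖ ^ 2) _ y :=
      ((hasFDerivAt_id y).sub_const p).norm_sq
    rw [this.fderiv]
    ext z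
    simp [two_smul]
  have h2 : HasFDerivAt (fun y : EuclideanSpace ℝ (Fin n) => (2 : ℝ) • innerSL ℝ (y - p))
      ((2 : ℝ) • (innerSL ℝ)) x :=
    (((innerSL ℝ).hasFDerivAt (x := x - p)).comp x ((hasFDerivAt_id x).sub_const p)).const_smul
      (2 : ℝ)
  have h3 : ∀ v : EuclideanSpace ℝ (Fin n), ((2 : ℝ) • innerSL ℝ) v v = 2 * ‖v‖ ^ 2 := fun v => by
    rw [← real_inner_self_eq_norm_sq]
    rfl
  rw [laplacian_eq_sum_fderiv, h1, h2.fderiv]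
  simp only [h3]
  simp [mul_comm]

theorem laplacian_clm {n : ℕ} (l : EuclideanSpace ℝ (Fin n) →L[ℝ] ℝ)
    (x : EuclideanSpace ℝ (Fin n)) : (Δ (fun y => l y)) x = 0 := by
  have h1 : fderiv ℝ (fun y => l y) = fun _ => l := funext fun y => l.fderiv
  rw [laplacian_eq_sum_fderiv, h1]
  simp

theorem laplacian_add_quadratic {n : ℕ} {f : EuclideanSpace ℝ (Fin n) → ℝ}
    {x : EuclideanSpace ℝ (Fin n)} (hf : ContDiffAt ℝ 2 f x) (a k : ℝ)
    (p : EuclideanSpace ℝ (Fin n)) (l : EuclideanSpace ℝ (Fin n) →L[ℝ] ℝ) :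
    ContDiffAt ℝ 2 (fun y => f y + a * ‖y - p‖ ^ 2 + l y + k) x ∧
      (Δ (fun y => f y + a * ‖y - p‖ ^ 2 + l y + k)) x = (Δ f) x + a * (2 * n) := by
  have hq : ContDiffAt ℝ 2 (fun z : EuclideanSpace ℝ (Fin n) => ‖z - p‖ ^ 2) x :=
    ((contDiff_id.sub contDiff_const).norm_sq ℝ).contDiffAt
  have h1 : ContDiffAt ℝ 2 (a • fun z : EuclideanSpace ℝ (Fin n) => ‖z - p‖ ^ 2) x :=
    contDiffAt_const.smul hq
  have h2 : ContDiffAt ℝ 2 (fun z => l z) x := l.contDiff.contDiffAt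
  have h3 : ContDiffAt ℝ 2 (fun _ : EuclideanSpace ℝ (Fin n) => k) x := contDiffAt_const
  have h12 : ContDiffAt ℝ 2 (f + a • fun z => ‖z - p‖ ^ 2) x := hf.add h1
  have h123 : ContDiffAt ℝ 2 ((f + a • fun z => ‖z - p‖ ^ 2) + fun z => l z) x := h12.add h2
  refine ⟨h123.add h3, ?_⟩
  have e : (fun y => f y + a * ‖y - p‖ ^ 2 + l y + k)
      = f + (a • fun z => ‖z - p‖ ^ 2) + (fun z => l z) + fun _ => k := rfl
  rw [e, h123.laplacian_add h3, h12.laplacian_add h2,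
    hf.laplacian_add h1, laplacian_smul _ hq, laplacian_norm_sub_sq, laplacian_clm]
  simp

/-! ### Maximum principles -/

theorem not_isLocalMax_of_laplacian_pos {n : ℕ} {f : EuclideanSpace ℝ (Fin n) → ℝ}
    {p : EuclideanSpace ℝ (Fin n)} (hf : ContDiffAt ℝ 2 f p) (hpos : 0 < (Δ f) p) :
    ¬ IsLocalMax f p := by
  intro hmax
  rw [laplacian_eq_sum_fderiv] at hpos
  obtain ⟨i, -, hi⟩ : ∃ i ∈ Finset.univ, 0 < fderiv ℝ (fderiv ℝ f) p (EuclideanSpace.single i 1)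
      (EuclideanSpace.single i 1) := by
    by_contra! h
    exact absurd hpos (not_lt.mpr (Finset.sum_nonpos h))
  set e : EuclideanSpace ℝ (Fin n) := EuclideanSpace.single i 1
  set γ : ℝ → EuclideanSpace ℝ (Fin n) := fun t => p + t • e with hγ
  have hγd : ∀ t, HasDerivAt γ e t := fun t => by
    have h := ((hasDerivAt_id t).smul_const e).const_add p
    rwa [one_smul] at h
  have hγ0 : γ 0 = p := by simp [hγ]
  have hγc : ContinuousAt γ 0 := (hγd 0).continuousAt
  have hev : ∀ᶠ t in nhds (0 : ℝ), deriv (f ∘ γ) t = fderiv ℝ f (γ t) e := by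
    have h1 : ∀ᶠ y in nhds p, ContDiffAt ℝ 2 f y := hf.eventually (by simp)
    rw [← hγ0] at h1
    filter_upwards [hγc.eventually h1] with t ht
    exact ((ht.differentiableAt (by simp)).hasFDerivAt.comp_hasDerivAt t (hγd t)).deriv
  have hdd : deriv (deriv (f ∘ γ)) 0 = fderiv ℝ (fderiv ℝ f) p e e := by
    rw [Filter.EventuallyEq.deriv_eq hev]
    have h2 : DifferentiableAt ℝ (fderiv ℝ f) (γ 0) := by
      rw [hγ0]
      exact (hf.fderiv_right (m := 1) (by norm_num)).differentiableAt (by simp)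
    have h3 := (h2.hasFDerivAt.comp_hasDerivAt 0 (hγd 0)).clm_apply (hasDerivAt_const 0 e)
    have h4 := h3.deriv
    simp only [Function.comp_def] at h4
    rw [h4, hγ0]
    simp
  have hcf : ContinuousAt (f ∘ γ) 0 :=
    ContinuousAt.comp (by rw [hγ0]; exact hf.continuousAt) hγc
  have hlmax : IsLocalMax (f ∘ γ) 0 := by
    have := hmax
    rw [IsLocalMax, IsMaxFilter, ← hγ0] at this
    exact hγc.eventually this
  have hd0 : deriv (f ∘ γ) 0 = 0 := hlmax.deriv_eq_zero
  -- Along a coordinate line with positive second derivative the maximum is also a minimum, so the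
  -- restriction is locally constant and that derivative vanishes.
  have hlmin : IsLocalMin (f ∘ γ) 0 :=
    isLocalMin_of_deriv_deriv_pos (by rw [hdd]; exact hi) hd0 hcf
  have hconst : (f ∘ γ) =ᶠ[nhds 0] fun _ => (f ∘ γ) 0 := by
    filter_upwards [hlmax, hlmin] with t h1 h2 using le_antisymm h1 h2
  have := (hconst.deriv).deriv_eq
  rw [hdd] at this
  simp at this
  exact hi.ne' this

/-- Weak maximum principle for strictly subharmonic functions on a compact set. -/
theorem nonpos_of_laplacian_pos {n : ℕ} {K : Set (EuclideanSpace ℝ (Fin n))}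
    {f : EuclideanSpace ℝ (Fin n) → ℝ} (hK : IsCompact K) (hc : ContinuousOn f K)
    (h : ∀ x ∈ K, 0 < f x → K ∈ nhds x ∧ ContDiffAt ℝ 2 f x ∧ 0 < (Δ f) x) :
    ∀ x ∈ K, f x ≤ 0 := by
  intro x hx
  obtain ⟨p, hp, hmax⟩ := hK.exists_isMaxOn ⟨x, hx⟩ hc
  by_contra! hlt
  obtain ⟨h1, h2, h3⟩ := h p hp (hlt.trans_le (hmax hx))
  exact not_isLocalMax_of_laplacian_pos h2 h3 (hmax.isLocalMax h1)

/-- Maximum principle on a ball. -/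
theorem nonpos_of_laplacian_nonneg {n : ℕ} (hn : 1 ≤ n) {y : EuclideanSpace ℝ (Fin n)} {r : ℝ}
    {f : EuclideanSpace ℝ (Fin n) → ℝ} (hc : ContinuousOn f (closedBall y r))
    (h : ∀ x ∈ ball y r, ContDiffAt ℝ 2 f x ∧ 0 ≤ (Δ f) x) (hs : ∀ x ∈ sphere y r, f x ≤ 0) :
    ∀ x ∈ closedBall y r, f x ≤ 0 := by
  have hn' : (0 : ℝ) < n := by exact_mod_cast hn
  have key : ∀ ε > 0, ∀ x ∈ closedBall y r,
      f x + ε * ‖x - y‖ ^ 2 + (0 : EuclideanSpace ℝ (Fin n) →L[ℝ] ℝ) x + -(ε * r ^ 2) ≤ 0 := by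
    intro ε hε
    refine nonpos_of_laplacian_pos (isCompact_closedBall y r) ?_ ?_
    · exact ((hc.add (by fun_prop)).add (by fun_prop)).add continuousOn_const
    · intro x hx hpos
      have hxb : x ∈ ball y r := by
        rcases (mem_closedBall.mp hx).lt_or_eq with h' | h'
        · exact h'
        · exfalso
          have := hs x h'
          rw [dist_eq_norm] at h'
          rw [h'] at hpos
          simp at hpos
          linarith
      obtain ⟨h1, h2⟩ := h x hxb
      obtain ⟨h3, h4⟩ := laplacian_add_quadratic h1 ε (-(ε * r ^ 2)) y 0
      refine ⟨Filter.mem_of_superset (isOpen_ball.mem_nhds hxb) ball_subset_closedBall, h3, ?_⟩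
      rw [h4]
      positivity
  intro x hx
  by_contra! hlt
  have h0 : 0 ≤ r := dist_nonneg.trans (mem_closedBall.mp hx)
  -- This `ε` is small enough that `ε * r ^ 2 < f x`, which avoids a limit.
  have := key (f x / (2 * (r ^ 2 + 1))) (by positivity) x hx
  rw [zero_apply] at this
  have h3 : 0 ≤ (f x / (2 * (r ^ 2 + 1))) * ‖x - y‖ ^ 2 := by positivity
  have h4 : f x / (2 * (r ^ 2 + 1)) * r ^ 2 < f x := by
    rw [div_mul_eq_mul_div, div_lt_iff₀ (by positivity)]
    nlinarith [sq_nonneg r]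
  linarith

/-! ### Harmonic polynomials and the Dirichlet problem on a ball -/

theorem contDiff_eval_mvPolynomial {n : ℕ} (P : MvPolynomial (Fin n) ℝ) {k : WithTop ℕ∞} :
    ContDiff ℝ k (fun x : EuclideanSpace ℝ (Fin n) => MvPolynomial.eval (fun i => x i) P) := by
  induction P using MvPolynomial.induction_on with
  | C a => simpa using contDiff_const
  | add p q hp hq => simpa using hp.add hq
  | mul_X p i hp =>
    simp only [map_mul, MvPolynomial.eval_X]
    exact hp.mul (by fun_prop)

theorem fderiv_eval_mvPolynomial {n : ℕ} (P : MvPolynomial (Fin n) ℝ)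
    (x : EuclideanSpace ℝ (Fin n)) (i : Fin n) :
    fderiv ℝ (fun x : EuclideanSpace ℝ (Fin n) => MvPolynomial.eval (fun i => x i) P) x
      (EuclideanSpace.single i 1) = MvPolynomial.eval (fun i => x i) (MvPolynomial.pderiv i P) := by
  have hd : ∀ P : MvPolynomial (Fin n) ℝ, DifferentiableAt ℝ
      (fun x : EuclideanSpace ℝ (Fin n) => MvPolynomial.eval (fun i => x i) P) x := fun P =>
    (contDiff_eval_mvPolynomial P (k := 1)).differentiable (by simp) x
  induction P using MvPolynomial.induction_on with
  | C a => simp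
  | add p q hp hq =>
    simp only [map_add]
    rw [fderiv_fun_add (hd p) (hd q)]
    simp [hp, hq]
  | mul_X p j hp =>
    have hX : HasFDerivAt (fun x : EuclideanSpace ℝ (Fin n) => x j)
        (EuclideanSpace.proj j : EuclideanSpace ℝ (Fin n) →L[ℝ] ℝ) x :=
      (EuclideanSpace.proj j : EuclideanSpace ℝ (Fin n) →L[ℝ] ℝ).hasFDerivAt
    simp only [map_mul, MvPolynomial.eval_X]
    rw [fderiv_fun_mul (hd p) hX.differentiableAt, hX.fderiv]
    simp only [MvPolynomial.pderiv_mul, map_add, map_mul, MvPolynomial.eval_X,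
      MvPolynomial.pderiv_X, add_apply, smul_apply, hp]
    by_cases h : j = i
    · subst h
      simp [mul_comm, add_comm]
    · simp [h, mul_comm]

/-- The Laplacian of multivariate polynomials. -/
noncomputable def MvPolynomial.laplacian (n : ℕ) :
    MvPolynomial (Fin n) ℝ →ₗ[ℝ] MvPolynomial (Fin n) ℝ :=
  ∑ i, (MvPolynomial.pderiv i).toLinearMap ∘ₗ (MvPolynomial.pderiv i).toLinearMap

theorem laplacian_eval_mvPolynomial {n : ℕ} (P : MvPolynomial (Fin n) ℝ)
    (x : EuclideanSpace ℝ (Fin n)) :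
    (Δ (fun x : EuclideanSpace ℝ (Fin n) => MvPolynomial.eval (fun i => x i) P)) x
      = MvPolynomial.eval (fun i => x i) (MvPolynomial.laplacian n P) := by
  rw [laplacian_eq_sum_fderiv, MvPolynomial.laplacian]
  simp only [LinearMap.sum_apply, map_sum]
  refine Finset.sum_congr rfl fun i _ => ?_
  have hd := ((contDiff_eval_mvPolynomial P (k := 2)).fderiv_right (m := 1)
    (by norm_num)).differentiable (by simp) x
  have h1 := (hd.hasFDerivAt.clm_apply (hasFDerivAt_const (EuclideanSpace.single i (1 : ℝ)) x)).fderiv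
  simp only [fderiv_eval_mvPolynomial] at h1
  have h2 := congrArg (fun L => L (EuclideanSpace.single i (1 : ℝ))) h1
  simp only [fderiv_eval_mvPolynomial] at h2
  simpa using h2.symm

/-- The coefficient of `m` in the second `i`-derivative is a multiple of the coefficient of `P` at
`m` raised by two in the variable `i`. -/
theorem MvPolynomial.totalDegree_laplacian_le {n : ℕ} {P : MvPolynomial (Fin n) ℝ} {k : ℕ}
    (h : P.totalDegree ≤ k + 2) : (MvPolynomial.laplacian n P).totalDegree ≤ k := by
  rw [MvPolynomial.laplacian, LinearMap.sum_apply]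
  refine MvPolynomial.totalDegree_finsetSum_le fun i _ => Finset.sup_le fun m hm => ?_
  rw [MvPolynomial.mem_support_iff] at hm
  simp only [LinearMap.comp_apply, Derivation.coeFn_coe, MvPolynomial.coeff_pderiv] at hm
  have h1 := MvPolynomial.le_totalDegree
    (MvPolynomial.mem_support_iff.mpr (left_ne_zero_of_mul (left_ne_zero_of_mul hm)))
  rw [Finsupp.sum_add_index' (by simp) (by simp), Finsupp.sum_add_index' (by simp) (by simp)] at h1
  simp only [Finsupp.sum_single_index] at h1
  omega

/-- The polynomial `R ^ 2 - |X - p| ^ 2`. -/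
noncomputable def MvPolynomial.spherePoly {n : ℕ} (p : EuclideanSpace ℝ (Fin n)) (R : ℝ) :
    MvPolynomial (Fin n) ℝ :=
  MvPolynomial.C (R ^ 2) - ∑ i, (MvPolynomial.X i - MvPolynomial.C (p i)) ^ 2

theorem MvPolynomial.eval_spherePoly {n : ℕ} (p x : EuclideanSpace ℝ (Fin n)) (R : ℝ) :
    MvPolynomial.eval (fun i => x i) (MvPolynomial.spherePoly p R) = R ^ 2 - ‖x - p‖ ^ 2 := by
  simp [MvPolynomial.spherePoly, EuclideanSpace.norm_sq_eq]

theorem MvPolynomial.totalDegree_spherePoly_le {n : ℕ} (p : EuclideanSpace ℝ (Fin n)) (R : ℝ) :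
    (MvPolynomial.spherePoly p R).totalDegree ≤ 2 := by
  refine (MvPolynomial.totalDegree_sub _ _).trans (max_le
    ((MvPolynomial.totalDegree_C _).trans_le (Nat.zero_le _)) ?_)
  refine MvPolynomial.totalDegree_finsetSum_le fun i _ => ?_
  refine (MvPolynomial.totalDegree_pow _ _).trans ?_
  have : (MvPolynomial.X i - MvPolynomial.C (p i) : MvPolynomial (Fin n) ℝ).totalDegree ≤ 1 :=
    (MvPolynomial.totalDegree_sub _ _).trans (max_le (by simp) (by simp))
  omega

/-- The ball contains a product of infinite sets, namely intervals. -/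
theorem MvPolynomial.eq_zero_of_eval_ball {n : ℕ} {p : EuclideanSpace ℝ (Fin n)} {R : ℝ}
    (hR : 0 < R) {Q : MvPolynomial (Fin n) ℝ}
    (h : ∀ x ∈ ball p R, MvPolynomial.eval (fun i => x i) Q = 0) : Q = 0 := by
  have hc : Continuous (WithLp.toLp 2 : (Fin n → ℝ) → EuclideanSpace ℝ (Fin n)) := by fun_prop
  obtain ⟨δ, hδ, hsub⟩ := Metric.isOpen_iff.mp (isOpen_ball.preimage hc) (p : Fin n → ℝ)
    (mem_ball_self hR : p ∈ ball p R)
  refine MvPolynomial.funext_set (fun i => ball (p i) δ)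
    (fun i => by rw [Real.ball_eq_Ioo]; exact Ioo_infinite (by linarith)) fun x hx => ?_
  rw [← ball_pi _ hδ] at hx
  simpa using h _ (hsub hx)

/-- Every polynomial agrees on a given sphere with a harmonic polynomial. -/
theorem MvPolynomial.exists_harmonic_eq_on_sphere {n : ℕ} (hn : 1 ≤ n)
    (p : EuclideanSpace ℝ (Fin n)) {R : ℝ} (hR : 0 < R) (P : MvPolynomial (Fin n) ℝ) :
    ∃ H : MvPolynomial (Fin n) ℝ, MvPolynomial.laplacian n H = 0 ∧
      ∀ x ∈ sphere p R, MvPolynomial.eval (fun i => x i) H = MvPolynomial.eval (fun i => x i) P := by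
  set k := P.totalDegree
  have hmem : ∀ Q ∈ MvPolynomial.restrictTotalDegree (Fin n) ℝ k,
      MvPolynomial.laplacian n (MvPolynomial.spherePoly p R * Q)
        ∈ MvPolynomial.restrictTotalDegree (Fin n) ℝ k := by
    intro Q hQ
    rw [MvPolynomial.mem_restrictTotalDegree] at hQ ⊢
    refine MvPolynomial.totalDegree_laplacian_le ((MvPolynomial.totalDegree_mul _ _).trans ?_)
    have := MvPolynomial.totalDegree_spherePoly_le p R
    omega
  -- Multiplying by the sphere polynomial raises the degree by at most two and the Laplacian lowers
  -- it by two, so `T` is an endomorphism of a finite-dimensional space: uniqueness for the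
  -- Dirichlet problem gives existence.
  set T : MvPolynomial.restrictTotalDegree (Fin n) ℝ k →ₗ[ℝ]
      MvPolynomial.restrictTotalDegree (Fin n) ℝ k :=
    (MvPolynomial.laplacian n ∘ₗ LinearMap.mulLeft ℝ (MvPolynomial.spherePoly p R)).restrict hmem
  have hinj : Function.Injective T := by
    rw [← LinearMap.ker_eq_bot, LinearMap.ker_eq_bot']
    rintro ⟨Q, hQ⟩ h0
    have h1 : MvPolynomial.laplacian n (MvPolynomial.spherePoly p R * Q) = 0 :=
      congrArg Subtype.val h0
    have hle : ∀ (s : ℝ), ∀ x ∈ closedBall p R,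
        MvPolynomial.eval (fun i => x i) (MvPolynomial.C s * (MvPolynomial.spherePoly p R * Q))
          ≤ 0 := by
      intro s
      refine nonpos_of_laplacian_nonneg hn (contDiff_eval_mvPolynomial _ (k := 2)).continuous.continuousOn
        (fun x _ => ⟨(contDiff_eval_mvPolynomial _).contDiffAt, ?_⟩) fun x hx => ?_
      · rw [laplacian_eval_mvPolynomial, ← MvPolynomial.smul_eq_C_mul, map_smul, h1]
        simp
      · rw [map_mul, map_mul, MvPolynomial.eval_spherePoly, ← dist_eq_norm, mem_sphere.mp hx]
        simp
    have hQ0 : Q = 0 := by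
      refine MvPolynomial.eq_zero_of_eval_ball (p := p) hR fun x hx => ?_
      have h2 := hle 1 x (ball_subset_closedBall hx)
      have h3 := hle (-1) x (ball_subset_closedBall hx)
      simp only [map_mul, MvPolynomial.eval_spherePoly, MvPolynomial.eval_C] at h2 h3
      have h4 : (0 : ℝ) < R ^ 2 - ‖x - p‖ ^ 2 := by
        have := mem_ball.mp hx
        rw [dist_eq_norm] at this
        nlinarith [norm_nonneg (x - p)]
      have h5 : (R ^ 2 - ‖x - p‖ ^ 2) * MvPolynomial.eval (fun i => x i) Q = 0 := by linarith
      exact (mul_eq_zero.mp h5).resolve_left h4.ne'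
    exact Subtype.ext hQ0
  have hsurj := LinearMap.injective_iff_surjective.mp hinj
  have hP : MvPolynomial.laplacian n P ∈ MvPolynomial.restrictTotalDegree (Fin n) ℝ k := by
    rw [MvPolynomial.mem_restrictTotalDegree]
    exact MvPolynomial.totalDegree_laplacian_le (Nat.le_add_right _ _)
  obtain ⟨⟨Q, hQ⟩, hTQ⟩ := hsurj ⟨_, hP⟩
  have h1 : MvPolynomial.laplacian n (MvPolynomial.spherePoly p R * Q)
      = MvPolynomial.laplacian n P := congrArg Subtype.val hTQ
  -- The correction vanishes on the sphere and has the same Laplacian as `P`.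
  refine ⟨P - MvPolynomial.spherePoly p R * Q, by rw [map_sub, h1, sub_self], fun x hx => ?_⟩
  rw [map_sub, map_mul, MvPolynomial.eval_spherePoly, ← dist_eq_norm, mem_sphere.mp hx]
  simp

/-- Approximate solvability of the Dirichlet problem on a ball. -/
theorem exists_harmonic_near_on_sphere {n : ℕ} (hn : 1 ≤ n) (p : EuclideanSpace ℝ (Fin n)) {R : ℝ}
    (hR : 0 < R) {F : EuclideanSpace ℝ (Fin n) → ℝ} (hF : Continuous F) {ε : ℝ}
    (hε : 0 < ε) :
    ∃ H : EuclideanSpace ℝ (Fin n) → ℝ, ContDiff ℝ 2 H ∧ (∀ x, (Δ H) x = 0) ∧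
      ∀ x ∈ sphere p R, |H x - F x| < ε := by
  let coord : MvPolynomial (Fin n) ℝ →ₐ[ℝ] C(EuclideanSpace ℝ (Fin n), ℝ) :=
    MvPolynomial.aeval fun i => ⟨fun x => x i, by fun_prop⟩
  have hcoord : ∀ P x, coord P x = MvPolynomial.eval (fun i => x i) P := by
    intro P x
    induction P using MvPolynomial.induction_on with
    | C a => simp [coord]
    | add p q hp hq => simp [hp, hq]
    | mul_X p i hp => simp [hp, coord]
  have hsep : coord.range.SeparatesPoints := by
    intro x y hxy
    obtain ⟨i, hi⟩ : ∃ i, x i ≠ y i := by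
      by_contra! h
      exact hxy (by ext i; exact h i)
    refine ⟨_, ⟨_, ⟨MvPolynomial.X i, rfl⟩, rfl⟩, ?_⟩
    show coord (MvPolynomial.X i) x ≠ coord (MvPolynomial.X i) y
    simpa [hcoord] using hi
  -- Stone–Weierstrass on the sphere; the polynomial is then replaced by a harmonic one with the
  -- same values there.
  obtain ⟨g, ⟨P, rfl⟩, hg⟩ :=
    ContinuousMap.exists_mem_subalgebra_near_continuous_of_isCompact_of_separatesPoints hsep
      ⟨F, hF⟩ (isCompact_sphere p R) hε
  obtain ⟨H, hH, hHP⟩ := MvPolynomial.exists_harmonic_eq_on_sphere hn p hR P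
  refine ⟨_, contDiff_eval_mvPolynomial H, fun x => ?_, fun x hx => ?_⟩
  · rw [laplacian_eval_mvPolynomial, hH, map_zero]
  · rw [hHP x hx, ← hcoord]
    exact hg x hx

/-! ### Mean value property and Harnack's inequality -/

theorem hasDerivAt_max_zero_sq (t : ℝ) : HasDerivAt (fun t : ℝ => max 0 t ^ 2) (2 * max 0 t) t := by
  rcases lt_trichotomy t 0 with h | h | h
  · have : (fun t : ℝ => max 0 t ^ 2) =ᶠ[nhds t] fun _ => 0 := by
      filter_upwards [Iio_mem_nhds h] with s hs
      simp [max_eq_left (mem_Iio.mp hs).le]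
    rw [max_eq_left h.le, mul_zero]
    exact (hasDerivAt_const t 0).congr_of_eventuallyEq this
  · subst h
    rw [hasDerivAt_iff_isLittleO_nhds_zero]
    have h1 : (fun h : ℝ => max 0 (0 + h) ^ 2 - max 0 (0 : ℝ) ^ 2 - h • (2 * max 0 (0 : ℝ)))
        =O[nhds 0] fun h : ℝ => h ^ 2 := by
      refine Asymptotics.isBigO_of_le _ fun h => ?_
      simp only [zero_add, max_self, mul_zero, smul_zero, sub_zero, norm_pow]
      rw [zero_pow two_ne_zero, sub_zero, norm_pow, Real.norm_of_nonneg (le_max_left 0 h)]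
      refine pow_le_pow_left₀ (le_max_left 0 h) ?_ 2
      exact max_le (abs_nonneg h) (le_abs_self h)
    exact h1.trans_isLittleO (Asymptotics.isLittleO_pow_id one_lt_two)
  · have : (fun t : ℝ => max 0 t ^ 2) =ᶠ[nhds t] fun t => t ^ 2 := by
      filter_upwards [Ioi_mem_nhds h] with s hs
      simp [max_eq_right (mem_Ioi.mp hs).le]
    rw [max_eq_right h.le]
    simpa using (hasDerivAt_pow 2 t).congr_of_eventuallyEq this

/-- The radial averaging kernel `(1 - |z| ^ 2)₊`. -/
noncomputable def averagingKernel {n : ℕ} (z : EuclideanSpace ℝ (Fin n)) : ℝ :=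
  max 0 (1 - ‖z‖ ^ 2)

theorem averagingKernel_nonneg {n : ℕ} (z : EuclideanSpace ℝ (Fin n)) : 0 ≤ averagingKernel z :=
  le_max_left _ _

theorem averagingKernel_le_one {n : ℕ} (z : EuclideanSpace ℝ (Fin n)) : averagingKernel z ≤ 1 :=
  max_le zero_le_one (by nlinarith [norm_nonneg z])

theorem continuous_averagingKernel {n : ℕ} :
    Continuous (averagingKernel : EuclideanSpace ℝ (Fin n) → ℝ) := by
  unfold averagingKernel
  fun_prop

theorem averagingKernel_eq_zero {n : ℕ} {z : EuclideanSpace ℝ (Fin n)} (hz : 1 ≤ ‖z‖) :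
    averagingKernel z = 0 :=
  max_eq_left (by nlinarith)

theorem hasCompactSupport_averagingKernel {n : ℕ} :
    HasCompactSupport (averagingKernel : EuclideanSpace ℝ (Fin n) → ℝ) :=
  HasCompactSupport.intro (isCompact_closedBall 0 1) fun z hz =>
    averagingKernel_eq_zero (by simpa using (not_le.mp (mt mem_closedBall.mpr hz)).le)

theorem hasFDerivAt_averagingKernel_sq {n : ℕ} (z : EuclideanSpace ℝ (Fin n)) :
    HasFDerivAt (fun z : EuclideanSpace ℝ (Fin n) => averagingKernel z ^ 2)
      ((-4 * averagingKernel z) • innerSL ℝ z) z := by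
  have h1 : HasFDerivAt (fun z : EuclideanSpace ℝ (Fin n) => 1 - ‖z‖ ^ 2) _ z :=
    (hasFDerivAt_id z).norm_sq.const_sub 1
  have h2 := (hasDerivAt_max_zero_sq (1 - ‖z‖ ^ 2)).comp_hasFDerivAt z h1
  refine h2.congr_fderiv ?_
  ext v
  simp [averagingKernel]
  ring

open MeasureTheory in
theorem integrable_averagingKernel_mul {n : ℕ} {f : EuclideanSpace ℝ (Fin n) → ℝ}
    (hf : Continuous f) : Integrable fun z => averagingKernel z * f z :=
  (continuous_averagingKernel.mul hf).integrable_of_hasCompactSupport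
    hasCompactSupport_averagingKernel.mul_right

-- With `η` the kernel, `η z` is `-1/4` times the gradient of `η ^ 2`. Integrating by parts moves
-- the derivative onto `V` and produces its Laplacian. Squaring the kernel makes it differentiable
-- across the unit sphere.
open MeasureTheory in
theorem integral_averagingKernel_mul_fderiv {n : ℕ} {V : EuclideanSpace ℝ (Fin n) → ℝ}
    (hV : ContDiff ℝ 2 V) (hΔ : ∀ x, (Δ V) x = 0) (x : EuclideanSpace ℝ (Fin n)) (s : ℝ) :
    ∫ z, averagingKernel z * fderiv ℝ V (x + s • z) z = 0 := by
  have hV1 : ContDiff ℝ 1 (fderiv ℝ V) := hV.fderiv_right (by norm_num)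
  have hV2 : Continuous (fderiv ℝ (fderiv ℝ V)) := (hV1.continuous_fderiv (by simp))
  have haff : ∀ z : EuclideanSpace ℝ (Fin n), HasFDerivAt (fun z => x + s • z)
      (s • ContinuousLinearMap.id ℝ (EuclideanSpace ℝ (Fin n))) z := fun z =>
    ((hasFDerivAt_id z).const_smul s).const_add x
  set e : Fin n → EuclideanSpace ℝ (Fin n) := fun i => EuclideanSpace.single i 1
  have hG : ∀ i z, HasFDerivAt (fun z => fderiv ℝ V (x + s • z) (e i))
      ((ContinuousLinearMap.apply ℝ ℝ (e i)).comp ((fderiv ℝ (fderiv ℝ V) (x + s • z)).comp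
        (s • ContinuousLinearMap.id ℝ (EuclideanSpace ℝ (Fin n))))) z := fun i z =>
    (ContinuousLinearMap.apply ℝ ℝ (e i)).hasFDerivAt.comp z
      (((hV1.differentiable (by simp)) (x + s • z)).hasFDerivAt.comp z (haff z))
  have hθ : ∀ i z, fderiv ℝ (fun z : EuclideanSpace ℝ (Fin n) => averagingKernel z ^ 2) z (e i)
      = -4 * averagingKernel z * z i := fun i z => by
    have h : inner ℝ z (e i) = z i := by simp [e, EuclideanSpace.inner_single_right]
    rw [(hasFDerivAt_averagingKernel_sq z).fderiv, ← h]
    rfl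
  have hGe : ∀ i z, fderiv ℝ (fun z => fderiv ℝ V (x + s • z) (e i)) z (e i)
      = s * fderiv ℝ (fderiv ℝ V) (x + s • z) (e i) (e i) := fun i z => by
    rw [(hG i z).fderiv]
    simp
  have hcG : ∀ i, Continuous fun z => fderiv ℝ V (x + s • z) (e i) := fun i =>
    (hV1.continuous.comp (by fun_prop)).clm_apply continuous_const
  have hcG2 : ∀ i, Continuous fun z => fderiv ℝ (fderiv ℝ V) (x + s • z) (e i) (e i) := fun i =>
    ((hV2.comp (by fun_prop)).clm_apply continuous_const).clm_apply continuous_const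
  have hibp : ∀ i, ∫ z, averagingKernel z ^ 2 *
        (s * fderiv ℝ (fderiv ℝ V) (x + s • z) (e i) (e i))
      = ∫ z, 4 * (averagingKernel z * (z i * fderiv ℝ V (x + s • z) (e i))) := by
    intro i
    have h := integral_mul_fderiv_eq_neg_fderiv_mul_of_integrable (𝕜 := ℝ)
      (μ := (volume : Measure (EuclideanSpace ℝ (Fin n)))) (v := e i)
      (f := fun z : EuclideanSpace ℝ (Fin n) => averagingKernel z ^ 2)
      (g := fun z => fderiv ℝ V (x + s • z) (e i)) ?_ ?_ ?_
      (fun z _ => (hasFDerivAt_averagingKernel_sq z).differentiableAt)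
      (fun z _ => (hG i z).differentiableAt)
    · simp only [hθ, hGe] at h
      rw [h, ← integral_neg]
      congr 1
      ext z
      ring
    · simp only [hθ]
      convert integrable_averagingKernel_mul (f := fun z => -4 * (z i) * fderiv ℝ V (x + s • z) (e i))
        (by have := hcG i; fun_prop) using 2
      ring
    · simp only [hGe]
      convert integrable_averagingKernel_mul (f := fun z => averagingKernel z *
        (s * fderiv ℝ (fderiv ℝ V) (x + s • z) (e i) (e i)))
        (by have := hcG2 i; have := continuous_averagingKernel (n := n); fun_prop) using 2
      ring
    · convert integrable_averagingKernel_mul (f := fun z => averagingKernel z *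
        fderiv ℝ V (x + s • z) (e i))
        (by have := hcG i; have := continuous_averagingKernel (n := n); fun_prop) using 2
      ring
  have hsum : ∑ i, ∫ z, averagingKernel z ^ 2 *
        (s * fderiv ℝ (fderiv ℝ V) (x + s • z) (e i) (e i)) = 0 := by
    rw [← integral_finsetSum]
    · simp only [← Finset.mul_sum]
      simp only [e, ← laplacian_eq_sum_fderiv, hΔ]
      simp
    · intro i _
      convert integrable_averagingKernel_mul (f := fun z => averagingKernel z *
        (s * fderiv ℝ (fderiv ℝ V) (x + s • z) (e i) (e i)))
        (by have := hcG2 i; have := continuous_averagingKernel (n := n); fun_prop) using 2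
      ring
  simp only [hibp] at hsum
  rw [← integral_finsetSum] at hsum
  · simp only [← Finset.mul_sum] at hsum
    rw [integral_const_mul] at hsum
    have hz : ∀ z, fderiv ℝ V (x + s • z) z = ∑ i, z i * fderiv ℝ V (x + s • z) (e i) := by
      intro z
      have h := congrArg (fderiv ℝ V (x + s • z)) ((EuclideanSpace.basisFun (Fin n) ℝ).sum_repr z)
      rw [← h, map_sum]
      simp [e]
    simp only [hz]
    linarith
  · intro i _
    exact (integrable_averagingKernel_mul (f := fun z => z i * fderiv ℝ V (x + s • z) (e i))
        (by have := hcG i; fun_prop)).const_mul 4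

open MeasureTheory in
/-- The mean value property of harmonic functions. -/
theorem integral_averagingKernel_mul_harmonic {n : ℕ} {V : EuclideanSpace ℝ (Fin n) → ℝ}
    (hV : ContDiff ℝ 2 V) (hΔ : ∀ x, (Δ V) x = 0) (x : EuclideanSpace ℝ (Fin n)) (s : ℝ) :
    ∫ z, averagingKernel z * V (x + s • z)
      = V x * ∫ z : EuclideanSpace ℝ (Fin n), averagingKernel z := by
  -- The average does not depend on the scale `s`, and at `s = 0` it is explicit.
  have hd : ∀ s₀ : ℝ, HasDerivAt (fun s : ℝ => ∫ z, averagingKernel z * V (x + s • z)) 0 s₀ := by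
    intro s₀
    obtain ⟨C, hC⟩ := (isCompact_closedBall x (|s₀| + 1)).exists_bound_of_continuousOn
      (hV.continuous_fderiv (by simp)).continuousOn
    have h := hasDerivAt_integral_of_dominated_loc_of_deriv_le
      (μ := (volume : Measure (EuclideanSpace ℝ (Fin n))))
      (F := fun (s : ℝ) z => averagingKernel z * V (x + s • z))
      (F' := fun (s : ℝ) z => averagingKernel z * fderiv ℝ V (x + s • z) z)
      (x₀ := s₀) (bound := fun z => averagingKernel z * C) (s := ball s₀ 1)
      (ball_mem_nhds s₀ one_pos) ?_ ?_ ?_ ?_ ?_ ?_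
    · rw [← integral_averagingKernel_mul_fderiv hV hΔ x s₀]
      exact h.2
    · exact Filter.Eventually.of_forall fun s =>
        (continuous_averagingKernel.mul (hV.continuous.comp (by fun_prop))).aestronglyMeasurable
    · exact integrable_averagingKernel_mul (hV.continuous.comp (by fun_prop))
    · exact (continuous_averagingKernel.mul (((hV.continuous_fderiv (by simp)).comp
        (by fun_prop)).clm_apply continuous_id)).aestronglyMeasurable
    · refine Filter.Eventually.of_forall fun z s hs => ?_
      rw [norm_mul, Real.norm_of_nonneg (averagingKernel_nonneg z)]
      rcases le_or_gt 1 ‖z‖ with hz | hz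
      · simp [averagingKernel_eq_zero hz]
      refine mul_le_mul_of_nonneg_left ?_ (averagingKernel_nonneg z)
      have hs' : |s| ≤ |s₀| + 1 := by
        have h1 := (mem_ball.mp hs).le
        rw [Real.dist_eq] at h1
        have h2 := abs_add_le (s - s₀) s₀
        rw [sub_add_cancel] at h2
        linarith
      have hmem : x + s • z ∈ closedBall x (|s₀| + 1) := by
        rw [mem_closedBall, dist_eq_norm, add_sub_cancel_left, norm_smul, Real.norm_eq_abs]
        nlinarith [abs_nonneg s, norm_nonneg z]
      refine ((fderiv ℝ V (x + s • z)).le_opNorm z).trans ?_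
      have := hC _ hmem
      nlinarith [norm_nonneg z, norm_nonneg (fderiv ℝ V (x + s • z))]
    · exact integrable_averagingKernel_mul continuous_const
    · refine Filter.Eventually.of_forall fun z s _ => ?_
      have h1 : HasDerivAt (fun s : ℝ => x + s • z) z s := by
        simpa using ((hasDerivAt_id s).smul_const z).const_add x
      exact ((hV.differentiable (by simp) _).hasFDerivAt.comp_hasDerivAt s h1).const_mul _
  have h0 := is_const_of_deriv_eq_zero (fun s => (hd s).differentiableAt) (fun s => (hd s).deriv) s 0
  rw [h0]
  simp only [zero_smul, add_zero]
  rw [integral_mul_const, mul_comm]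

open MeasureTheory in
theorem integral_averagingKernel_pos {n : ℕ} :
    0 < ∫ z : EuclideanSpace ℝ (Fin n), averagingKernel z :=
  continuous_averagingKernel.integral_pos_of_hasCompactSupport_nonneg_nonzero
    hasCompactSupport_averagingKernel averagingKernel_nonneg (x := 0) (by simp [averagingKernel])

open MeasureTheory in
/-- Harnack's inequality. -/
theorem harnack_of_harmonic {n : ℕ} {V : EuclideanSpace ℝ (Fin n) → ℝ}
    (hV : ContDiff ℝ 2 V) (hΔ : ∀ x, (Δ V) x = 0) {p x : EuclideanSpace ℝ (Fin n)} {R : ℝ}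
    (hR : 0 < R) (hpos : ∀ y ∈ closedBall p R, 0 ≤ V y) (hx : ‖x - p‖ ≤ 9 / 16 * R) :
    V x ≤ 3 * 4 ^ n * V p := by
  set a : EuclideanSpace ℝ (Fin n) := R⁻¹ • (x - p) with ha
  have hna : ‖a‖ ≤ 9 / 16 := by
    rw [ha, norm_smul, norm_inv, Real.norm_of_nonneg hR.le, inv_mul_le_iff₀ hR]
    linarith
  set f : EuclideanSpace ℝ (Fin n) → ℝ := fun z => averagingKernel z * V (p + R • z) with hf
  have hfi : Integrable f := integrable_averagingKernel_mul (hV.continuous.comp (by fun_prop))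
  have hf0 : ∀ z, 0 ≤ f z := by
    intro z
    rcases le_or_gt 1 ‖z‖ with hz | hz
    · simp [hf, averagingKernel_eq_zero hz]
    · refine mul_nonneg (averagingKernel_nonneg z) (hpos _ ?_)
      rw [mem_closedBall, dist_eq_norm, add_sub_cancel_left, norm_smul, Real.norm_of_nonneg hR.le]
      nlinarith
  -- The average about `x` at scale `R / 4` is compared with the one about `p` at scale `R`; the
  -- Jacobian is the factor `4 ^ n`.
  have hcv : ∫ y, f (a + (1 / 4 : ℝ) • y) = 4 ^ n * ∫ z, f z := by
    have h1 := Measure.integral_comp_smul (volume : Measure (EuclideanSpace ℝ (Fin n)))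
      (fun y => f (a + y)) (1 / 4 : ℝ)
    rw [h1, integral_add_left_eq_self]
    simp
  have hle : ∫ y, averagingKernel y * V (x + (R / 4) • y) ≤ ∫ y, 3 * f (a + (1 / 4 : ℝ) • y) := by
    refine integral_mono (integrable_averagingKernel_mul (hV.continuous.comp (by fun_prop)))
      (((hfi.comp_add_left a).comp_smul (by norm_num)).const_mul 3) fun y => ?_
    rcases le_or_gt 1 ‖y‖ with hy | hy
    · simp only [averagingKernel_eq_zero hy, zero_mul]
      exact mul_nonneg (by norm_num) (hf0 _)
    · have hpt : p + R • (a + (1 / 4 : ℝ) • y) = x + (R / 4) • y := by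
        rw [ha, smul_add, smul_smul, mul_inv_cancel₀ hR.ne', smul_smul, one_smul, ← add_assoc,
          add_sub_cancel]
        congr 2
        ring
      have hn2 : ‖a + (1 / 4 : ℝ) • y‖ ≤ 13 / 16 := by
        refine (norm_add_le _ _).trans ?_
        rw [norm_smul (1 / 4 : ℝ) y, Real.norm_of_nonneg (by norm_num : (0 : ℝ) ≤ 1 / 4)]
        linarith
      -- The small ball stays within relative radius `9/16 + 1/4 = 13/16`, where the kernel is at
      -- least `87/256 > 1/3`.
      have hk : 1 ≤ 3 * averagingKernel (a + (1 / 4 : ℝ) • y) := by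
        have : 1 - ‖a + (1 / 4 : ℝ) • y‖ ^ 2 ≤ averagingKernel (a + (1 / 4 : ℝ) • y) :=
          le_max_right _ _
        nlinarith [norm_nonneg (a + (1 / 4 : ℝ) • y)]
      have hVn : 0 ≤ V (x + (R / 4) • y) := by
        refine hpos _ ?_
        rw [← hpt, mem_closedBall, dist_eq_norm, add_sub_cancel_left, norm_smul,
          Real.norm_of_nonneg hR.le]
        nlinarith
      simp only [hf, hpt]
      have := averagingKernel_le_one y
      nlinarith
  rw [integral_averagingKernel_mul_harmonic hV hΔ, integral_const_mul, hcv,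
    integral_averagingKernel_mul_harmonic hV hΔ] at hle
  have hZ := integral_averagingKernel_pos (n := n)
  refine le_of_mul_le_mul_right (hle.trans_eq ?_) hZ
  ring

/-! ### Regularising, gluing and comparing competitors -/

theorem HarmonicAt.comp_smul_add {n : ℕ} {f : EuclideanSpace ℝ (Fin n) → ℝ} {a : ℝ}
    {v x : EuclideanSpace ℝ (Fin n)} (hf : HarmonicAt f (a • x + v)) (k : ℝ) :
    HarmonicAt (fun y => f (a • y + v) + k) x := by
  have hc : ContDiff ℝ 2 fun y : EuclideanSpace ℝ (Fin n) => a • y + v := by fun_prop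
  have h1 : HarmonicAt (fun y => f (a • y + v)) x := by
    refine ⟨hf.1.comp x hc.contDiffAt, ?_⟩
    filter_upwards [hc.continuous.continuousAt.eventually hf.2] with y hy
    rw [laplacian_comp_smul_add, hy]
    simp
  exact h1.add (harmonicAt_const k)

theorem le_of_harmonic_of_le_sphere {n : ℕ} (hn : 1 ≤ n) {y : EuclideanSpace ℝ (Fin n)} {r : ℝ}
    {h : EuclideanSpace ℝ (Fin n) → ℝ} (hc : ContinuousOn h (closedBall y r))
    (hh : HarmonicOnNhd h (ball y r)) {m : ℝ} (hs : ∀ x ∈ sphere y r, m ≤ h x) :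
    ∀ x ∈ closedBall y r, m ≤ h x := by
  intro x hx
  refine sub_nonpos.mp (nonpos_of_laplacian_nonneg hn (f := fun x => m - h x)
    (continuousOn_const.sub hc) (fun z hz => ?_) (fun z hz => sub_nonpos.mpr (hs z hz)) x hx)
  have := (harmonicAt_const (x := z) m).sub (hh z hz)
  exact ⟨this.1, this.2.self_of_nhds.ge⟩

/-- A subharmonic function below a Lipschitz obstacle can be replaced by a continuous one, at the
expense of a small loss and a small shift of the points. -/
theorem IsSubharmonicOn.exists_continuous {n : ℕ} (hn : 1 ≤ n) {c : EuclideanSpace ℝ (Fin n)}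
    {φ : EuclideanSpace ℝ (Fin n) → ℝ} {L M : ℝ} (hL : 0 ≤ L)
    (hLip : ∀ x ∈ ball c 1, ∀ y ∈ ball c 1, φ x ≤ φ y + L * ‖y - x‖)
    (hM : ∀ x ∈ ball c 1, |φ x| ≤ M) {f : EuclideanSpace ℝ (Fin n) → EReal}
    (hf : IsSubharmonicOn f (ball c 1)) (hle : ∀ z ∈ ball c 1, f z ≤ (φ z : EReal))
    {δ : ℝ} (hδ : 0 < δ) (hδ1 : δ < 1) {x₀ : EuclideanSpace ℝ (Fin n)} (hx₀ : x₀ ∈ ball c 1) :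
    ∃ F : EuclideanSpace ℝ (Fin n) → ℝ, Continuous F ∧
      IsSubharmonicOn (fun x => (F x : EReal)) (ball c 1) ∧ (∀ x ∈ ball c 1, F x ≤ φ x) ∧
      f x₀ ≤ ((F (c + (1 - δ)⁻¹ • (x₀ - c)) + L * δ : ℝ) : EReal) := by
  have hδ' : 0 < 1 - δ := by linarith
  have hM0 : 0 ≤ M := (abs_nonneg _).trans (hM c (mem_ball_self one_pos))
  -- Truncation at `-M` makes the function real-valued and keeps it below `φ`.
  set g : EuclideanSpace ℝ (Fin n) → ℝ := fun z => (max (f z) ((-M : ℝ) : EReal)).toReal with hg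
  have hgc : ∀ z ∈ ball c 1, (g z : EReal) = max (f z) ((-M : ℝ) : EReal) := by
    intro z hz
    refine EReal.coe_toReal ?_ ?_
    · exact (max_lt (hf.lt_top z hz) (EReal.coe_lt_top _)).ne
    · exact ((EReal.bot_lt_coe (-M)).trans_le (le_max_right _ _)).ne'
  have hgf : ∀ z ∈ ball c 1, f z ≤ (g z : EReal) := fun z hz => by
    rw [hgc z hz]
    exact le_max_left _ _
  have hgle : ∀ z ∈ ball c 1, ∀ t : ℝ, f z ≤ (t : EReal) → -M ≤ t → g z ≤ t := by
    intro z hz t h1 h2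
    rw [← EReal.coe_le_coe_iff, hgc z hz]
    exact max_le h1 (EReal.coe_le_coe_iff.mpr h2)
  have hgM : ∀ z ∈ ball c 1, -M ≤ g z := fun z hz => by
    rw [← EReal.coe_le_coe_iff, hgc z hz]
    exact le_max_right _ _
  have hgφ : ∀ z ∈ ball c 1, g z ≤ φ z := fun z hz =>
    hgle z hz _ (hle z hz) (neg_le_of_abs_le (hM z hz))
  have hgM' : ∀ z ∈ ball c 1, g z ≤ M := fun z hz =>
    (hgφ z hz).trans ((le_abs_self _).trans (hM z hz))
  -- Slope at least `L` keeps the sup-convolution controlled by `φ`; the extra `2 * M / δ` makes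
  -- points at distance `δ` or more irrelevant.
  set k : ℝ := L + 2 * M / δ with hk
  have hk0 : 0 ≤ k := by positivity
  have hkL : L ≤ k := by
    have : 0 ≤ 2 * M / δ := by positivity
    linarith
  -- The contraction leaves room for shifts of length below `δ` inside the unit ball.
  set D : EuclideanSpace ℝ (Fin n) → EuclideanSpace ℝ (Fin n) := fun x => c + (1 - δ) • (x - c)
    with hD
  have hDsub : ∀ x y, D x - D y = (1 - δ) • (x - y) := fun x y => by
    simp only [hD]
    module
  have hDc : D c = c := by simp [hD]
  have hDball : ∀ x ∈ ball c 1, ‖D x - c‖ < 1 - δ := fun x hx => by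
    have h1 := hDsub x c
    rw [hDc] at h1
    rw [h1, norm_smul, Real.norm_of_nonneg hδ'.le]
    have := mem_ball_iff_norm.mp hx
    nlinarith
  have hDmem : ∀ x ∈ ball c 1, D x ∈ ball c 1 := fun x hx => by
    have := hDball x hx
    rw [mem_ball_iff_norm]
    linarith
  have : Nonempty (ball c 1) := ⟨⟨c, mem_ball_self one_pos⟩⟩
  set S : EuclideanSpace ℝ (Fin n) → ℝ := fun x => ⨆ z : ball c 1, g z - k * ‖D x - z‖ with hS
  have hbdd : ∀ x, BddAbove (range fun z : ball c 1 => g z - k * ‖D x - z‖) := by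
    intro x
    refine ⟨M, ?_⟩
    rintro _ ⟨z, rfl⟩
    have h1 := hgM' z z.2
    have h2 : 0 ≤ k * ‖D x - z‖ := by positivity
    simp only
    linarith
  have hSge : ∀ x, ∀ z ∈ ball c 1, g z - k * ‖D x - z‖ ≤ S x := fun x z hz =>
    le_ciSup (hbdd x) ⟨z, hz⟩
  have hSM : ∀ x ∈ ball c 1, -M ≤ S x := fun x hx => by
    have h1 := hSge x (D x) (hDmem x hx)
    have h2 := hgM _ (hDmem x hx)
    simp at h1
    linarith
  have hScont : Continuous S := by
    refine (LipschitzWith.of_le_add_mul (k * (1 - δ)).toNNReal fun x y => ?_).continuous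
    rw [Real.coe_toNNReal _ (by positivity)]
    refine ciSup_le fun z => ?_
    have h1 := hSge y z z.2
    have h2 : ‖D y - z‖ ≤ ‖D x - z‖ + (1 - δ) * ‖x - y‖ := by
      have h3 : D y - z = (D x - z) - (D x - D y) := by abel
      rw [h3]
      refine (norm_sub_le _ _).trans ?_
      rw [hDsub, norm_smul, Real.norm_of_nonneg hδ'.le]
    rw [dist_eq_norm]
    nlinarith
  refine ⟨fun x => S x - L * δ, hScont.sub continuous_const, ⟨fun x _ => EReal.coe_lt_top _,
    (continuous_coe_real_ereal.comp
      (hScont.sub continuous_const)).upperSemicontinuous.upperSemicontinuousOn _, ?_⟩, ?_, ?_⟩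
  · intro y r hr hsub h hc hh hs w hw
    simp only [EReal.coe_le_coe_iff] at hs ⊢
    have hwc : w ∈ closedBall y r := ball_subset_closedBall hw
    have hlow : -M - L * δ ≤ h w := by
      refine le_of_harmonic_of_le_sphere hn hc hh (fun x hx => ?_) w hwc
      have h1 := hs x hx
      have h2 := hSM x (hsub (sphere_subset_closedBall hx))
      linarith
    rw [sub_le_iff_le_add]
    refine ciSup_le fun ⟨z, hz⟩ => ?_
    rcases le_or_gt δ ‖D w - z‖ with hbig | hsmall
    · have h1 := hgM' z hz
      have h2 : k * δ ≤ k * ‖D w - z‖ := mul_le_mul_of_nonneg_left hbig hk0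
      have h3 : k * δ = L * δ + 2 * M := by
        rw [hk]
        field_simp
      have h4 : 0 ≤ L * δ := by positivity
      simp only
      linarith
    -- For a fixed short shift `v`, subharmonicity of `f` is applied on the image of the ball under
    -- `x ↦ D x + v`; `E` is the inverse of this map.
    · set v := z - D w with hv
      have hnv : ‖D w - z‖ = ‖v‖ := norm_sub_rev _ _
      set a : ℝ := (1 - δ)⁻¹ with ha
      have ha0 : 0 < a := inv_pos.mpr hδ'
      have haδ : a * (1 - δ) = 1 := inv_mul_cancel₀ hδ'.ne'
      set E : EuclideanSpace ℝ (Fin n) → EuclideanSpace ℝ (Fin n) :=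
        fun q => a • q + (y - a • (D y + v)) with hE
      have hEy : ∀ q, q - (D y + v) = (1 - δ) • (E q - y) := fun q => by
        have : E q - y = a • (q - (D y + v)) := by
          simp only [hE]
          module
        rw [this, smul_smul, mul_comm, haδ, one_smul]
      have hED : ∀ q, q = D (E q) + v := fun q => by
        have h1 := hEy q
        rw [← hDsub] at h1
        rw [← sub_eq_zero]
        rw [← sub_eq_zero] at h1
        rw [← h1]
        abel
      have hnE : ∀ q, dist q (D y + v) = (1 - δ) * dist (E q) y := fun q => by
        rw [dist_eq_norm, hEy, norm_smul, Real.norm_of_nonneg hδ'.le, dist_eq_norm]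
      have hsub' : closedBall (D y + v) ((1 - δ) * r) ⊆ ball c 1 := by
        intro q hq
        rw [mem_closedBall, hnE] at hq
        have h1 := hDball (E q) (hsub (mem_closedBall.mpr (le_of_mul_le_mul_left hq hδ')))
        rw [mem_ball_iff_norm]
        have h2 : q - c = (D (E q) - c) + v := by
          nth_rewrite 1 [hED q]
          abel
        rw [h2]
        refine (norm_add_le _ _).trans_lt ?_
        linarith
      have hEz : E z = w := by
        simp only [hE, hv, hD]
        have : a • (1 - δ) • (w - y) = w - y := by rw [smul_smul, haδ, one_smul]
        have h2 : a • z + (y - a • (c + (1 - δ) • (y - c) + (z - (c + (1 - δ) • (w - c)))))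
          = y + a • (1 - δ) • (w - y) := by module
        rw [h2, this]
        abel
      have hcE : Continuous E := by fun_prop
      have key := hf.le_harmonic (D y + v) ((1 - δ) * r) (by positivity) hsub'
        (fun q => h (E q) + (k * ‖v‖ + L * δ)) ?_ ?_ ?_ z ?_
      · rw [hEz] at key
        have h1 := hgle z hz _ key (by
          have : 0 ≤ k * ‖v‖ := by positivity
          linarith)
        rw [hnv]
        linarith
      · refine (hc.comp hcE.continuousOn fun q hq => ?_).add continuousOn_const
        rw [mem_closedBall, hnE] at hq
        exact mem_closedBall.mpr (le_of_mul_le_mul_left hq hδ')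
      · intro q hq
        rw [mem_ball, hnE] at hq
        exact HarmonicAt.comp_smul_add (hh (E q) (mem_ball.mpr (lt_of_mul_lt_mul_left hq hδ'.le))) _
      · intro q hq
        have hqm := hsub' (sphere_subset_closedBall hq)
        rw [mem_sphere, hnE] at hq
        have hEs : E q ∈ sphere y r := mem_sphere.mpr (mul_left_cancel₀ hδ'.ne' hq)
        refine (hgf q hqm).trans (EReal.coe_le_coe_iff.mpr ?_)
        have h1 := hSge (E q) q hqm
        have h2 : D (E q) - q = -v := by
          nth_rewrite 2 [hED q]
          abel
        rw [h2, norm_neg] at h1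
        have h3 := hs _ hEs
        linarith
      · rw [mem_ball, hnE, hEz]
        exact mul_lt_mul_of_pos_left (mem_ball.mp hw) hδ'
  · intro x hx
    rw [sub_le_iff_le_add]
    refine ciSup_le fun ⟨z, hz⟩ => ?_
    -- Going from `z` to `D x` costs at most the penalty; going on to `x` costs `L * δ`, which was
    -- subtracted in the definition of the new function.
    have h1 := hgφ z hz
    have h2 := hLip z hz (D x) (hDmem x hx)
    have h3 := hLip (D x) (hDmem x hx) x hx
    have h4 : ‖x - D x‖ ≤ δ := by
      have : x - D x = δ • (x - c) := by
        simp only [hD]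
        module
      rw [this, norm_smul, Real.norm_of_nonneg hδ.le]
      have := mem_ball_iff_norm.mp hx
      nlinarith
    have h5 : L * ‖D x - z‖ ≤ k * ‖D x - z‖ := by gcongr
    have h6 : L * ‖x - D x‖ ≤ L * δ := by gcongr
    simp only
    linarith
  · refine (hgf x₀ hx₀).trans (EReal.coe_le_coe_iff.mpr ?_)
    have hDp : D (c + (1 - δ)⁻¹ • (x₀ - c)) = x₀ := by
      simp only [hD, add_sub_cancel_left, smul_smul, mul_inv_cancel₀ hδ'.ne', one_smul,
        add_sub_cancel]
    have h1 := hSge (c + (1 - δ)⁻¹ • (x₀ - c)) x₀ hx₀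
    rw [hDp] at h1
    simp at h1
    simp only
    linarith

open Classical in
/-- Gluing a subharmonic function with a strictly subharmonic one that lies below it on a sphere. -/
theorem IsSubharmonicOn.glue {n : ℕ} (hn : 1 ≤ n) {U : Set (EuclideanSpace ℝ (Fin n))}
    {F : EuclideanSpace ℝ (Fin n) → ℝ} (hFc : Continuous F)
    (hF : IsSubharmonicOn (fun x => (F x : EReal)) U) {p : EuclideanSpace ℝ (Fin n)} {R A : ℝ}
    (hR : 0 < R) (hA : 0 < A) {H : EuclideanSpace ℝ (Fin n) → ℝ}
    (hH : ContDiff ℝ 2 H) (hΔ : ∀ x, (Δ H) x = 0) (hlt : ∀ x ∈ sphere p R, H x < F x) :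
    IsSubharmonicOn (fun x => (((ball p R).piecewise
      (fun x => max (F x) (H x + A * (‖x - p‖ ^ 2 - R ^ 2))) F x : ℝ) : EReal)) U := by
  set W : EuclideanSpace ℝ (Fin n) → ℝ := fun x => H x + A * (‖x - p‖ ^ 2 - R ^ 2) with hW
  have hWc : Continuous W := by
    have := hH.continuous
    fun_prop
  have hWs : ∀ x ∈ sphere p R, W x = H x := fun x hx => by
    simp [hW, ← dist_eq_norm, mem_sphere.mp hx]
  set G : EuclideanSpace ℝ (Fin n) → ℝ := (ball p R).piecewise (fun x => max (F x) (W x)) F with hG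
  have hGF : ∀ x, F x ≤ G x := fun x => by
    by_cases hx : x ∈ ball p R
    · simp [hG, hx]
    · simp [hG, hx]
  have hGc : Continuous G := by
    refine Continuous.piecewise (fun x hx => ?_) (hFc.max hWc) hFc
    rw [frontier_ball p hR.ne'] at hx
    rw [max_eq_left]
    rw [hWs x hx]
    exact (hlt x hx).le
  refine ⟨fun x _ => EReal.coe_lt_top _,
    (continuous_coe_real_ereal.comp hGc).upperSemicontinuous.upperSemicontinuousOn _, ?_⟩
  intro y r hr hsub h hc hh hs z hz
  simp only [EReal.coe_le_coe_iff] at hs ⊢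
  have hFh : ∀ x ∈ closedBall y r, F x ≤ h x := by
    have h1 : ∀ x ∈ sphere y r, F x ≤ h x := fun x hx => (hGF x).trans (hs x hx)
    intro x hx
    rcases (mem_closedBall.mp hx).lt_or_eq with h' | h'
    · exact EReal.coe_le_coe_iff.mp (hF.le_harmonic y r hr hsub h hc hh
        (fun w hw => EReal.coe_le_coe_iff.mpr (h1 w hw)) x h')
    · exact h1 x h'
  by_cases hzp : z ∈ ball p R
  swap
  · rw [hG, piecewise_eq_of_notMem _ _ _ hzp]
    exact hFh z (ball_subset_closedBall hz)
  rw [hG, piecewise_eq_of_mem _ _ _ hzp]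
  refine max_le (hFh z (ball_subset_closedBall hz)) (sub_nonpos.mp ?_)
  -- A positive value of `W - h` can occur on neither bounding sphere: on that of `ball p R`, `W = H
  -- < F ≤ h`; on that of `ball y r`, inside `ball p R`, `W` is below the glued function, hence
  -- below `h`.
  refine nonpos_of_laplacian_pos (f := fun x => W x - h x)
    ((isCompact_closedBall p R).inter_right (isClosed_closedBall (x := y) (ε := r)))
    (hWc.continuousOn.sub (hc.mono inter_subset_right)) ?_ z
    ⟨ball_subset_closedBall hzp, ball_subset_closedBall hz⟩
  rintro x ⟨hxp, hxy⟩ hpos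
  have hxp' : x ∈ ball p R := by
    rcases (mem_closedBall.mp hxp).lt_or_eq with h' | h'
    · exact h'
    · have h1 := hWs x h'
      have h2 := hlt x h'
      have h3 := hFh x hxy
      linarith
  have hxy' : x ∈ ball y r := by
    rcases (mem_closedBall.mp hxy).lt_or_eq with h' | h'
    · exact h'
    · have h1 := hs x h'
      rw [hG, piecewise_eq_of_mem _ _ _ hxp'] at h1
      have h2 := le_max_right (F x) (W x)
      linarith
  refine ⟨Filter.mem_of_superset ((isOpen_ball.inter isOpen_ball).mem_nhds ⟨hxp', hxy'⟩)
    (inter_subset_inter ball_subset_closedBall ball_subset_closedBall), ?_⟩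
  have hHh := hh x hxy'
  obtain ⟨h1, h2⟩ := laplacian_add_quadratic (hH.contDiffAt.sub hHh.1) A (-A * R ^ 2) p 0
  have e : (fun x => W x - h x) = fun x => (H x - h x) + A * ‖x - p‖ ^ 2
      + (0 : EuclideanSpace ℝ (Fin n) →L[ℝ] ℝ) x + -A * R ^ 2 := by
    funext x
    simp only [hW, zero_apply]
    ring
  have e2 : (Δ (fun x => H x - h x)) x = 0 := by
    refine (hH.contDiffAt.laplacian_sub hHh.1).trans ?_
    rw [hΔ, hHh.2.self_of_nhds]
    simp
  rw [e]
  refine ⟨h1, ?_⟩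
  rw [h2, e2]
  have hn' : (0 : ℝ) < n := by exact_mod_cast hn
  positivity

/-- Since `b` need not be twice differentiable, it is replaced at an interior maximum `q` of the
difference by the paraboloid touching it from above at `q`. The difference with the paraboloid still
has a maximum at `q`, but its Laplacian is `2 * n * (A - N) > 0`. -/
theorem harmonic_add_quadratic_le {n : ℕ} (hn : 1 ≤ n) {p : EuclideanSpace ℝ (Fin n)} {R A N : ℝ}
    (hNA : N < A) {H b : EuclideanSpace ℝ (Fin n) → ℝ}
    {g : EuclideanSpace ℝ (Fin n) → EuclideanSpace ℝ (Fin n)}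
    (hH : ContDiff ℝ 2 H) (hΔ : ∀ x, (Δ H) x = 0) (hb : ContinuousOn b (closedBall p R))
    (hbg : ∀ x ∈ ball p R, ∀ y ∈ ball p R, b y ≤ b x + inner ℝ (g x) (y - x) + N * ‖y - x‖ ^ 2)
    (hle : ∀ x ∈ sphere p R, H x ≤ b x) :
    ∀ x ∈ closedBall p R, H x + A * (‖x - p‖ ^ 2 - R ^ 2) ≤ b x := by
  intro x hx
  set W : EuclideanSpace ℝ (Fin n) → ℝ := fun x => H x + A * (‖x - p‖ ^ 2 - R ^ 2) with hW
  have hWc : Continuous W := by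
    have := hH.continuous
    fun_prop
  obtain ⟨q, hq, hmax⟩ := (isCompact_closedBall p R).exists_isMaxOn ⟨x, hx⟩ (hWc.continuousOn.sub hb)
  have hmax' : ∀ y ∈ closedBall p R, W y - b y ≤ W q - b q := fun y hy => hmax hy
  by_contra! hlt
  have hxq := hmax' x hx
  have hqb : q ∈ ball p R := by
    rcases (mem_closedBall.mp hq).lt_or_eq with h' | h'
    · exact h'
    · have h1 := hle q h'
      have h2 : W q = H q := by simp [hW, ← dist_eq_norm, h']
      simp only [hW] at hlt hxq h2
      linarith
  have e : W = fun x => H x + A * ‖x - p‖ ^ 2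
      + (0 : EuclideanSpace ℝ (Fin n) →L[ℝ] ℝ) x + -A * R ^ 2 := by
    funext x
    simp only [hW, zero_apply]
    ring
  obtain ⟨h1, h2⟩ := laplacian_add_quadratic (hH.contDiffAt (x := q)) A (-A * R ^ 2) p 0
  rw [← e, hΔ] at h2
  rw [← e] at h1
  obtain ⟨h3, h4⟩ := laplacian_add_quadratic h1 (-N) 0 q (-innerSL ℝ (g q))
  refine not_isLocalMax_of_laplacian_pos h3 ?_ ?_
  · rw [h4, h2]
    have hn' : (0 : ℝ) < n := by exact_mod_cast hn
    nlinarith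
  · filter_upwards [isOpen_ball.mem_nhds hqb] with y hy
    have h5 := hbg q hqb y hy
    have h6 := hmax' y (ball_subset_closedBall hy)
    rw [inner_sub_right] at h5
    simp
    linarith

/-! ### Estimates for functions of class `C^{1,1}` -/

theorem MemC11.bounds {n : ℕ} {U : Set (EuclideanSpace ℝ (Fin n))} {f : EuclideanSpace ℝ (Fin n) → ℝ}
    (hf : MemC11 U f) {x : EuclideanSpace ℝ (Fin n)} (hx : x ∈ U) :
    |f x| ≤ (c2Norm U f).toReal ∧ ‖∇ f x‖ ≤ (c2Norm U f).toReal ∧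
      ∀ y ∈ U, ‖∇ f x - ∇ f y‖ ≤ (c2Norm U f).toReal * ‖x - y‖ := by
  have hfin : c2Norm U f ≠ ⊤ := hf.2.ne
  have conv : ∀ {F : Type} [NormedAddCommGroup F] (v : F), ‖v‖ₑ ≤ c2Norm U f →
      ‖v‖ ≤ (c2Norm U f).toReal := fun v hv => by
    have := ENNReal.toReal_mono hfin hv
    rwa [toReal_enorm] at this
  refine ⟨?_, ?_, fun y hy => ?_⟩
  · rw [← Real.norm_eq_abs]
    refine conv _ ?_
    refine (le_iSup₂ (f := fun x (_ : x ∈ U) => ‖f x‖ₑ) x hx).trans ?_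
    rw [c2Norm, add_assoc]
    exact le_self_add
  · refine conv _ ?_
    refine (le_iSup₂ (f := fun x (_ : x ∈ U) => ‖∇ f x‖ₑ) x hx).trans ?_
    rw [c2Norm]
    exact le_add_self.trans le_self_add
  · by_cases hxy : x = y
    · simp [hxy]
    have h1 : ‖∇ f x - ∇ f y‖ₑ / edist x y ≤ c2Norm U f := by
      refine (le_iSup₂ (f := fun y (_ : y ∈ U) => ‖∇ f x - ∇ f y‖ₑ / edist x y) y hy).trans ?_
      refine (le_iSup₂ (f := fun x (_ : x ∈ U) => ⨆ y ∈ U, ‖∇ f x - ∇ f y‖ₑ / edist x y) x hx).trans ?_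
      rw [c2Norm]
      exact le_add_self
    rw [ENNReal.div_le_iff (by simpa using hxy) (edist_ne_top x y)] at h1
    have h2 := ENNReal.toReal_mono (ENNReal.mul_ne_top hfin (edist_ne_top x y)) h1
    rwa [ENNReal.toReal_mul, toReal_enorm, ← dist_edist, dist_eq_norm] at h2

theorem MemC11.hasFDerivAt {n : ℕ} {U : Set (EuclideanSpace ℝ (Fin n))}
    {f : EuclideanSpace ℝ (Fin n) → ℝ} (hf : MemC11 U f) (hU : IsOpen U)
    {x : EuclideanSpace ℝ (Fin n)} (hx : x ∈ U) : HasFDerivAt f (innerSL ℝ (∇ f x)) x :=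
  (hf.1.differentiableAt (hU.mem_nhds hx)).hasGradientAt.hasFDerivAt

theorem MemC11.abs_sub_le {n : ℕ} {U : Set (EuclideanSpace ℝ (Fin n))}
    {f : EuclideanSpace ℝ (Fin n) → ℝ} (hf : MemC11 U f) (hU : IsOpen U) (hconv : Convex ℝ U)
    {x y : EuclideanSpace ℝ (Fin n)} (hx : x ∈ U) (hy : y ∈ U) :
    |f y - f x| ≤ (c2Norm U f).toReal * ‖y - x‖ :=
  hconv.norm_image_sub_le_of_norm_hasFDerivWithin_le
    (fun _ hz => (hf.hasFDerivAt hU hz).hasFDerivWithinAt)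
    (fun _ hz => (innerSL_apply_norm ℝ _).trans_le (hf.bounds hz).2.1) hx hy

/-- Mean value inequality on the segment, for `f` minus its linear part at `x`; the sharp factor
`1/2` is not needed. -/
theorem MemC11.taylor {n : ℕ} {U : Set (EuclideanSpace ℝ (Fin n))}
    {f : EuclideanSpace ℝ (Fin n) → ℝ} (hf : MemC11 U f) (hU : IsOpen U) (hconv : Convex ℝ U)
    {x y : EuclideanSpace ℝ (Fin n)} (hx : x ∈ U) (hy : y ∈ U) :
    |f y - f x - inner ℝ (∇ f x) (y - x)| ≤ (c2Norm U f).toReal * ‖y - x‖ ^ 2 := by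
  have hseg : segment ℝ x y ⊆ U := hconv.segment_subset hx hy
  have h := (convex_segment x y).norm_image_sub_le_of_norm_hasFDerivWithin_le'
    (f := f) (f' := fun z => innerSL ℝ (∇ f z)) (φ := innerSL ℝ (∇ f x))
    (C := (c2Norm U f).toReal * ‖y - x‖)
    (fun z hz => (hf.hasFDerivAt hU (hseg hz)).hasFDerivWithinAt) (fun _ hz => ?_)
    (left_mem_segment ℝ x y) (right_mem_segment ℝ x y)
  · rw [pow_two, ← mul_assoc]
    exact h
  · rw [← map_sub, innerSL_apply_norm]
    refine ((hf.bounds (hseg hz)).2.2 x hx).trans ?_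
    refine mul_le_mul_of_nonneg_left ?_ ENNReal.toReal_nonneg
    exact norm_sub_le_of_mem_segment hz

/-! ### Bounds for the envelope -/

theorem le_subharmonicEnvelope {n : ℕ} {U : Set (EuclideanSpace ℝ (Fin n))}
    {φ : EuclideanSpace ℝ (Fin n) → ℝ} {f : EuclideanSpace ℝ (Fin n) → EReal}
    (hf : IsSubharmonicOn f U) (hle : ∀ z ∈ U, f z ≤ (φ z : EReal))
    (x : EuclideanSpace ℝ (Fin n)) : f x ≤ subharmonicEnvelope U φ x :=
  le_sSup ⟨f, hf, hle, rfl⟩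

theorem subharmonicEnvelope_le {n : ℕ} {U : Set (EuclideanSpace ℝ (Fin n))}
    {φ : EuclideanSpace ℝ (Fin n) → ℝ} {x : EuclideanSpace ℝ (Fin n)} (hx : x ∈ U) :
    subharmonicEnvelope U φ x ≤ (φ x : EReal) := by
  refine sSup_le ?_
  rintro _ ⟨f, -, hle, rfl⟩
  exact hle x hx

/-- The quadratic lower bound for the envelope at a contact point. -/
theorem le_subharmonicEnvelope_of_mem_contactSet {n : ℕ} (hn : 1 ≤ n)
    {c : EuclideanSpace ℝ (Fin n)} {b : Fin 2 → EuclideanSpace ℝ (Fin n) → ℝ}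
    (hb : ∀ j, MemC11 (ball c 1) (b j)) {N : ℝ} (hN : ∀ j, (c2Norm (ball c 1) (b j)).toReal ≤ N)
    {x₀ : EuclideanSpace ℝ (Fin n)}
    (hx₀ : x₀ ∈ contactSet (ball c 1) (fun z => min (b 0 z) (b 1 z)))
    (hx₀c : x₀ ∈ ball c (1 / 4)) {i : Fin 2} (hi : min (b 0 x₀) (b 1 x₀) = b i x₀)
    {x : EuclideanSpace ℝ (Fin n)} (hx : x ∈ ball x₀ (1 / 8)) (hne : x ≠ x₀) :
    ((b i x₀ + inner ℝ (∇ (b i) x₀) (x - x₀)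
        - (3 * 4 ^ n * (11 * N + 2) + 4 * (N + 1)) * ‖x - x₀‖ ^ 2 : ℝ) : EReal)
      ≤ subharmonicEnvelope (ball c 1) (fun z => min (b 0 z) (b 1 z)) x := by
  classical
  set U := ball c 1 with hU
  set φ : EuclideanSpace ℝ (Fin n) → ℝ := fun z => min (b 0 z) (b 1 z) with hφ
  have hUo : IsOpen U := isOpen_ball
  have hUc : Convex ℝ U := convex_ball c 1
  have hx₀U : x₀ ∈ U := hx₀.1
  have hN0 : 0 ≤ N := ENNReal.toReal_nonneg.trans (hN 0)
  have hφb : ∀ j z, φ z ≤ b j z := fun j z => by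
    fin_cases j
    · exact min_le_left _ _
    · exact min_le_right _ _
  have hφle : ∀ z t, (∀ j, t ≤ b j z) → t ≤ φ z := fun z t h => le_min (h 0) (h 1)
  have hlip : ∀ j, ∀ y ∈ U, ∀ z ∈ U, |b j z - b j y| ≤ N * ‖z - y‖ := fun j y hy z hz =>
    ((hb j).abs_sub_le hUo hUc hy hz).trans (by gcongr; exact hN j)
  have htay : ∀ j, ∀ y ∈ U, ∀ z ∈ U,
      b j z ≤ b j y + inner ℝ (∇ (b j) y) (z - y) + N * ‖z - y‖ ^ 2 := fun j y hy z hz => by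
    have h1 := (le_abs_self _).trans ((hb j).taylor hUo hUc hy hz)
    have h2 := mul_le_mul_of_nonneg_right (hN j) (sq_nonneg ‖z - y‖)
    linarith
  have hφlip : ∀ y ∈ U, ∀ z ∈ U, φ y ≤ φ z + N * ‖z - y‖ := fun y hy z hz => by
    rw [← sub_le_iff_le_add]
    refine hφle z _ fun j => ?_
    have h1 := neg_le_of_abs_le (hlip j y hy z hz)
    have h2 := hφb j y
    linarith
  have hφM : ∀ y ∈ U, |φ y| ≤ N := fun y hy => by
    have h : ∀ j, |b j y| ≤ N := fun j => ((hb j).bounds hy).1.trans (hN j)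
    exact abs_le.mpr ⟨hφle y _ fun j => neg_le_of_abs_le (h j),
      (hφb 0 y).trans ((le_abs_self _).trans (h 0))⟩
  set r : ℝ := ‖x - x₀‖ with hr
  have hr0 : 0 < r := norm_pos_iff.mpr (sub_ne_zero.mpr hne)
  have hr8 : r < 1 / 8 := mem_ball_iff_norm.mp hx
  -- One parameter serves for every loss: near-optimality at `x₀`, regularisation and harmonic
  -- approximation.
  set δ : ℝ := r ^ 2 with hδ
  have hδ0 : 0 < δ := by positivity
  have hδr : δ ≤ r / 8 := by rw [hδ]; nlinarith
  have hδ1 : δ < 1 := by linarith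
  set g : EuclideanSpace ℝ (Fin n) := ∇ (b i) x₀ with hg
  have hgN : ‖g‖ ≤ N := ((hb i).bounds hx₀U).2.1.trans (hN i)
  obtain ⟨_, ⟨f, hf, hfφ, rfl⟩, hfx₀⟩ : ∃ t ∈ {t : EReal | ∃ f : EuclideanSpace ℝ (Fin n) → EReal,
      IsSubharmonicOn f U ∧ (∀ z ∈ U, f z ≤ (φ z : EReal)) ∧ t = f x₀},
      ((b i x₀ - δ : ℝ) : EReal) < t := by
    refine lt_sSup_iff.mp (lt_of_lt_of_eq ?_ hx₀.2.symm)
    have h : φ x₀ = b i x₀ := hi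
    rw [EReal.coe_lt_coe_iff, h]
    linarith
  obtain ⟨F, hFc, hF, hFφ, hFp⟩ :=
    hf.exists_continuous hn hN0 hφlip hφM hfφ hδ0 hδ1 hx₀U
  set p : EuclideanSpace ℝ (Fin n) := c + (1 - δ)⁻¹ • (x₀ - c) with hp
  have hx₀n : ‖x₀ - c‖ < 1 / 4 := mem_ball_iff_norm.mp hx₀c
  have hpx₀ : ‖p - x₀‖ ≤ δ := by
    have h0 : 0 < 1 - δ := by linarith
    have h1 : p - x₀ = (δ * (1 - δ)⁻¹) • (x₀ - c) := by
      have h2 : δ * (1 - δ)⁻¹ = (1 - δ)⁻¹ - 1 := by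
        field_simp
        ring
      rw [h2, hp]
      module
    have h3 : (1 - δ)⁻¹ ≤ 4 := inv_le_of_inv_le₀ (by norm_num) (by linarith)
    have h4 : 0 < (1 - δ)⁻¹ := inv_pos.mpr h0
    rw [h1, norm_smul, Real.norm_of_nonneg (by positivity), mul_assoc]
    refine mul_le_of_le_one_right hδ0.le ?_
    nlinarith [norm_nonneg (x₀ - c)]
  have hFp' : b i x₀ - δ ≤ F p + N * δ := EReal.coe_le_coe_iff.mp (hfx₀.le.trans hFp)
  set R : ℝ := 2 * r with hR
  have hR0 : 0 < R := by positivity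
  have hsub : closedBall p R ⊆ U := by
    intro y hy
    have h1 : ‖y - p‖ ≤ R := mem_closedBall_iff_norm.mp hy
    have h2 : y - c = (y - p) + (p - x₀) + (x₀ - c) := by abel
    rw [hU, mem_ball_iff_norm, h2]
    refine (norm_add₃_le).trans_lt ?_
    linarith
  -- Aiming at `F - δ / 2` with tolerance `δ / 2` gives `H < F < H + δ` on the sphere.
  obtain ⟨H, hHc, hHΔ, hHF⟩ := exists_harmonic_near_on_sphere hn p hR0
    (F := fun y => F y - δ / 2) (by fun_prop) (half_pos hδ0)
  have hHlt : ∀ y ∈ sphere p R, H y < F y := fun y hy => by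
    have := (abs_lt.mp (hHF y hy)).2
    linarith
  have hHgt : ∀ y ∈ sphere p R, F y ≤ H y + δ := fun y hy => by
    have := (abs_lt.mp (hHF y hy)).1
    linarith
  have hHp : F p ≤ H p + δ := by
    refine EReal.coe_le_coe_iff.mp (hF.le_harmonic p R hR0 hsub (fun y => H y + δ)
      (hHc.continuous.add continuous_const).continuousOn (fun y _ => ?_)
      (fun y hy => EReal.coe_le_coe_iff.mpr (hHgt y hy)) p (mem_ball_self hR0))
    exact HarmonicAt.add ⟨hHc.contDiffAt, Filter.Eventually.of_forall hHΔ⟩ (harmonicAt_const δ)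
  have hWb : ∀ j, ∀ y ∈ closedBall p R, H y + (N + 1) * (‖y - p‖ ^ 2 - R ^ 2) ≤ b j y := by
    intro j
    refine harmonic_add_quadratic_le hn (N := N) (g := ∇ (b j)) (by linarith) hHc hHΔ
      (fun y hy => ((hb j).hasFDerivAt hUo (hsub hy)).continuousAt.continuousWithinAt)
      (fun y hy z hz => htay j y (hsub (ball_subset_closedBall hy)) z
        (hsub (ball_subset_closedBall hz))) fun y hy => ?_
    exact (hHlt y hy).le.trans ((hFφ y (hsub (sphere_subset_closedBall hy))).trans (hφb j y))
  have hG := hF.glue hn hFc hR0 (A := N + 1) (by linarith) hHc hHΔ hHlt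
  -- Here `r + δ ≤ 9 / 8 * r`, and `R = 2 * r`.
  have hxp : ‖x - p‖ ≤ 9 / 16 * R := by
    have h1 : x - p = (x - x₀) - (p - x₀) := by abel
    rw [h1]
    refine (norm_sub_le _ _).trans ?_
    linarith
  have hxpR : x ∈ ball p R := mem_ball_iff_norm.mpr (by linarith)
  have hGx := le_subharmonicEnvelope (φ := φ) hG (fun y hy => by
    rw [EReal.coe_le_coe_iff]
    by_cases hyp : y ∈ ball p R
    · rw [piecewise_eq_of_mem _ _ _ hyp]
      exact max_le (hFφ y hy) (hφle y _ fun j => hWb j y (ball_subset_closedBall hyp))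
    · rw [piecewise_eq_of_notMem _ _ _ hyp]
      exact hFφ y hy) x
  refine le_trans (EReal.coe_le_coe_iff.mpr ?_) hGx
  rw [piecewise_eq_of_mem _ _ _ hxpR]
  refine le_trans ?_ (le_max_right _ _)
  -- On the sphere `‖y - x₀‖ ≤ R + δ ≤ 3 * r`, so this constant makes `V` nonnegative there. The
  -- zero quadratic term only matches `laplacian_add_quadratic`.
  set k : ℝ := b i x₀ - inner ℝ g x₀ + N * (3 * r) ^ 2 with hk
  set V : EuclideanSpace ℝ (Fin n) → ℝ :=
    fun y => (-H) y + 0 * ‖y - p‖ ^ 2 + innerSL ℝ g y + k with hV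
  have hVe : ∀ y, V y = b i x₀ + inner ℝ g (y - x₀) + N * (3 * r) ^ 2 - H y := fun y => by
    rw [inner_sub_right]
    simp only [hV, hk, Pi.neg_apply, innerSL_apply_apply]
    ring
  have hVq := fun y => laplacian_add_quadratic (x := y) hHc.neg.contDiffAt 0 k p (innerSL ℝ g)
  have hVc : ContDiff ℝ 2 V := contDiff_iff_contDiffAt.mpr fun y => (hVq y).1
  have hVΔ : ∀ y, (Δ V) y = 0 := fun y => by
    refine (hVq y).2.trans ?_
    have : (Δ (-H)) y = -(Δ H) y := congrFun laplacian_neg y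
    refine (congrArg (· + (0 : ℝ) * (2 * n)) this).trans ?_
    simp [hHΔ]
  have hVpos : ∀ y ∈ closedBall p R, 0 ≤ V y := by
    refine le_of_harmonic_of_le_sphere hn hVc.continuous.continuousOn
      (fun y _ => ⟨hVc.contDiffAt, Filter.Eventually.of_forall hVΔ⟩) fun y hy => ?_
    have hyU := hsub (sphere_subset_closedBall hy)
    have h1 := htay i x₀ hx₀U y hyU
    have h2 := (hHlt y hy).le.trans ((hFφ y hyU).trans (hφb i y))
    have h3 : ‖y - x₀‖ ≤ 3 * r := by
      have h4 : y - x₀ = (y - p) + (p - x₀) := by abel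
      have h5 : ‖y - p‖ = R := mem_sphere_iff_norm.mp hy
      rw [h4]
      refine (norm_add_le _ _).trans ?_
      linarith
    have h6 : N * ‖y - x₀‖ ^ 2 ≤ N * (3 * r) ^ 2 := by gcongr
    rw [hVe]
    linarith
  have hharnack := harnack_of_harmonic hVc hVΔ hR0 hVpos hxp
  -- Nine `N` come from `(3 * r) ^ 2`, one from the slope over `p - x₀`, one from regularisation;
  -- the `2` is near-optimality plus harmonic approximation.
  have hVp : V p ≤ (11 * N + 2) * r ^ 2 := by
    have h1 : inner ℝ g (p - x₀) ≤ N * δ := (real_inner_le_norm _ _).trans (by gcongr)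
    rw [hVe]
    simp only [hδ] at *
    linarith
  have h4n : (0 : ℝ) < 3 * 4 ^ n := by positivity
  have h1 := hharnack.trans (mul_le_mul_of_nonneg_left hVp h4n.le)
  rw [hVe] at h1
  have h2 : 0 ≤ (N + 1) * ‖x - p‖ ^ 2 := by positivity
  have h3 : 0 ≤ N * (3 * r) ^ 2 := by positivity
  simp only [hR]
  linarith

theorem proposition4p5 (n : ℕ) (hn : 1 ≤ n) :
    ∃ C : ℝ≥0∞ → ℝ≥0∞ → ℝ,
      ∀ (c : EuclideanSpace ℝ (Fin n)) (b : Fin 2 → EuclideanSpace ℝ (Fin n) → ℝ),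
        (∀ j, MemC11 (ball c 1) (b j)) →
        ∀ x₀ ∈ contactSet (ball c 1) (fun z => min (b 0 z) (b 1 z)) ∩ ball c (1 / 4),
        ∀ i : Fin 2, min (b 0 x₀) (b 1 x₀) = b i x₀ →
        ∀ x ∈ ball x₀ (1 / 8), ∃ t : ℝ,
          subharmonicEnvelope (ball c 1) (fun z => min (b 0 z) (b 1 z)) x = (t : EReal) ∧
          |t - b i x₀ - inner ℝ (∇ (b i) x₀) (x - x₀)| ≤
            C (c2Norm (ball c 1) (b 0)) (c2Norm (ball c 1) (b 1)) * ‖x - x₀‖ ^ 2 := by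
  refine ⟨fun s t => 3 * 4 ^ n * (11 * (s.toReal + t.toReal) + 2)
    + 4 * ((s.toReal + t.toReal) + 1), ?_⟩
  rintro c b hb x₀ ⟨hx₀, hx₀c⟩ i hi x hx
  -- The lower bound works at scale `‖x - x₀‖`, which must be positive.
  by_cases hne : x = x₀
  · subst hne
    exact ⟨b i x, by rw [← hi]; exact hx₀.2, by simp⟩
  set N := (c2Norm (ball c 1) (b 0)).toReal + (c2Norm (ball c 1) (b 1)).toReal with hNdef
  have hN : ∀ j, (c2Norm (ball c 1) (b j)).toReal ≤ N := fun j => by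
    have h0 : 0 ≤ (c2Norm (ball c 1) (b 0)).toReal := ENNReal.toReal_nonneg
    have h1 : 0 ≤ (c2Norm (ball c 1) (b 1)).toReal := ENNReal.toReal_nonneg
    fin_cases j
    · exact le_add_of_nonneg_right h1
    · exact le_add_of_nonneg_left h0
  have hN0 : 0 ≤ N := ENNReal.toReal_nonneg.trans (hN 0)
  have hlow := le_subharmonicEnvelope_of_mem_contactSet hn hb hN hx₀ hx₀c hi hx hne
  have hxU : x ∈ ball c 1 := by
    have h1 := mem_ball.mp hx
    have h2 := mem_ball.mp hx₀c
    have h3 := dist_triangle x x₀ c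
    rw [mem_ball]
    linarith
  have hup := subharmonicEnvelope_le (φ := fun z => min (b 0 z) (b 1 z)) hxU
  have hφb : min (b 0 x) (b 1 x) ≤ b i x := by
    fin_cases i
    · exact min_le_left _ _
    · exact min_le_right _ _
  -- The two bounds also exclude infinite values of the envelope.
  have hfin : subharmonicEnvelope (ball c 1) (fun z => min (b 0 z) (b 1 z)) x
      = ((subharmonicEnvelope (ball c 1) (fun z => min (b 0 z) (b 1 z)) x).toReal : EReal) :=
    (EReal.coe_toReal (hup.trans_lt (EReal.coe_lt_top _)).ne
      ((EReal.bot_lt_coe _).trans_le hlow).ne').symm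
  refine ⟨_, hfin, ?_⟩
  rw [hfin, EReal.coe_le_coe_iff] at hlow hup
  have htay := (le_abs_self _).trans ((hb i).taylor isOpen_ball (convex_ball c 1) hx₀.1 hxU)
  have h1 : (c2Norm (ball c 1) (b i)).toReal * ‖x - x₀‖ ^ 2 ≤ N * ‖x - x₀‖ ^ 2 := by
    gcongr
    exact hN i
  have h2 : N * ‖x - x₀‖ ^ 2
      ≤ (3 * 4 ^ n * (11 * N + 2) + 4 * (N + 1)) * ‖x - x₀‖ ^ 2 := by
    have : 0 ≤ 3 * 4 ^ n * (11 * N + 2) := by positivity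
    gcongr
    linarith
  rw [abs_le]
  constructor
  · linarith
  · linarith
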